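/- Let $M$ be a smooth (Hausdorff) $N$-dimensional manifold, $x\in M$, let $g_{ab}$ be a Lorentzian metric of signature $(+,-,\dots,-)$ on $T_xM$, and let $T_{ab}$ be a rank-2 covariant tensor at $x$. Write $(T\times T)_{ab}=T_{ac}T_b{}^c$, and for a smooth real function $\phi$ on $M$ put $$T_{ab}\{\phi\}=\nabla_a\phi\,\nabla_b\phi-\tfrac12(\nabla\phi\cdot\nabla\phi)\,g_{ab}\quad\text{at }x ,$$ the energy-momentum tensor of the minimally coupled massless scalar field $\phi$. Consider the conditions (R) $T_{ab}$ is symmetric, $(T\times T)_{ab}=f g_{ab}$ for some real $f$, $T_{ab}T^{ab}\ge 0$, and $T_a{}^a=\beta\sqrt{T_{ab}T^{ab}/N}$ with $\beta=N-2$ or $\beta=2-N$. Then: 1. Up to sign, $T_{ab}$ is algebraically the energy-momentum tensor of a scalar field if and only if (R) holds: there are $\epsilon\in\{1,-1\}$ and a smooth $\phi$ with $\epsilon T_{ab}=T_{ab}\{\phi\}$ at $x$ if and only if (R). 2. The sign is $+$ exactly under the dominant property: there is a smooth $\phi$ with $T_{ab}=T_{ab}\{\phi\}$ at $x$ if and only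 if (R) holds and $T_{ab}u^aw^b\ge 0$ for all future-pointing causal $u,w\in T_xM$ (for either choice of time-orientation). 3. If $N\neq 2$, the requirement $T_{ab}T^{ab}\ge0$ in (R) follows from symmetry and $(T\times T)_{ab}=fg_{ab}$. 4. Suppose $\epsilon\in\{1,-1\}$ and $\epsilon T_{ab}=T_{ab}\{\phi\}$ at $x$. If $\epsilon T_a{}^a=(N-2)\sqrt{T_{ab}T^{ab}/N}$ and $T_a{}^a\neq0$, then $d\phi$ is spacelike at $x$; if $\epsilon T_a{}^a=(2-N)\sqrt{T_{ab}T^{ab}/N}$ and $T_a{}^a\neq 0$, then $d\phi$ is timelike at $x$; if $T_a{}^a=0=T_{ab}T^{ab}$, then $d\phi$ is null at $x$ (nonzero with $\nabla\phi\cdot\nabla\phi=0$), or $T_{ab}=0$ and $d\phi=0$ at $x$. -/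

import Mathlib

open scoped Manifold ContDiff

noncomputable section

/-- A Lorentzian scalar product of signature `(+,-,…,-)` on a real vector space: symmetric, with a
vector of positive square whose orthogonal complement is negative definite. -/
structure LorentzForm (V : Type*) [AddCommGroup V] [Module ℝ V] where
  form : LinearMap.BilinForm ℝ V
  symm : ∀ u v, form u v = form v u
  signature : ∃ t, 0 < form t t ∧ ∀ v, v ≠ 0 → form t v = 0 → form v v < 0

namespace LorentzForm

variable {V : Type*} [AddCommGroup V] [Module ℝ V]

theorem nondegenerate (g : LorentzForm V) : g.form.Nondegenerate := by
  have key : ∀ v, (∀ w, g.form v w = 0) → v = 0 := by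
    intro v hv
    obtain ⟨t, -, ht⟩ := g.signature
    by_contra hne
    have h1 := ht v hne (by rw [g.symm]; exact hv t)
    rw [hv v] at h1
    exact lt_irrefl _ h1
  exact ⟨key, fun v hv => key v fun w => by rw [g.symm]; exact hv w⟩

variable [FiniteDimensional ℝ V]

/-- Raising an index: `α_a ↦ g^{ab} α_b`. -/
def sharp (g : LorentzForm V) : Module.Dual ℝ V →ₗ[ℝ] V :=
  (g.form.toDual g.nondegenerate).symm.toLinearMap

/-- The inverse metric on 1-forms: `α · β = g^{ab} α_a β_b`. -/
def cometric (g : LorentzForm V) : LinearMap.BilinForm ℝ (Module.Dual ℝ V) :=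
  g.form.compl₁₂ g.sharp g.sharp

/-- `(S × T)_{ab} = S_{ac} T_b{}^c = g^{cd} S_{ac} T_{bd}`. -/
def cross (g : LorentzForm V) (S T : LinearMap.BilinForm ℝ V) : LinearMap.BilinForm ℝ V :=
  g.cometric.compl₁₂ S T

/-- `T_a{}^a = g^{ab} T_{ab}`. -/
def metricTrace (g : LorentzForm V) (T : LinearMap.BilinForm ℝ V) : ℝ :=
  LinearMap.trace ℝ V (g.sharp ∘ₗ T)

/-- `S_{ab} T^{ab} = g^{ac} g^{bd} S_{ab} T_{cd}`, which is the trace of `S × T`. -/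
def contraction (g : LorentzForm V) (S T : LinearMap.BilinForm ℝ V) : ℝ :=
  g.metricTrace (g.cross S T)

/-- `α_a α_b - (1/2) (α · α) g_{ab}`. -/
def scalarEnergyMomentum (g : LorentzForm V) (α : Module.Dual ℝ V) : LinearMap.BilinForm ℝ V :=
  LinearMap.BilinForm.linMulLin α α - ((1 / 2 : ℝ) * g.cometric α α) • g.form

def IsSpacelike (g : LorentzForm V) (α : Module.Dual ℝ V) : Prop := g.cometric α α < 0

def IsTimelike (g : LorentzForm V) (α : Module.Dual ℝ V) : Prop := 0 < g.cometric α α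

def IsNull (g : LorentzForm V) (α : Module.Dual ℝ V) : Prop := α ≠ 0 ∧ g.cometric α α = 0

end LorentzForm

/-- `u` is causal and future-pointing, for the time-orientation given by the timelike vector `t`. -/
def LorentzForm.IsFutureCausal {V : Type*} [AddCommGroup V] [Module ℝ V]
    (g : LorentzForm V) (t u : V) : Prop :=
  0 ≤ g.form u u ∧ 0 < g.form t u

/-- The dominant property of a rank-2 tensor, for the time-orientation given by `t`. -/
def LorentzForm.HasDominantProperty {V : Type*} [AddCommGroup V] [Module ℝ V]
    (g : LorentzForm V) (t : V) (T : LinearMap.BilinForm ℝ V) : Prop :=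
  ∀ u w, g.IsFutureCausal t u → g.IsFutureCausal t w → 0 ≤ T u w

instance tangentSpace_finiteDimensional {N : ℕ} {M : Type*} [TopologicalSpace M]
    [ChartedSpace (EuclideanSpace ℝ (Fin N)) M] (x : M) :
    FiniteDimensional ℝ (TangentSpace (𝓡 N) x) :=
  inferInstanceAs (FiniteDimensional ℝ (EuclideanSpace ℝ (Fin N)))

/-- The 1-form `dφ` at the point `x`. -/
def differentialAt {N : ℕ} {M : Type*} [TopologicalSpace M]
    [ChartedSpace (EuclideanSpace ℝ (Fin N)) M] (φ : M → ℝ) (x : M) :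
    Module.Dual ℝ (TangentSpace (𝓡 N) x) :=
  (mvfderiv (𝓡 N) φ x).toLinearMap

/-- `T` is, at the point `x`, the energy-momentum tensor
`∇_a φ ∇_b φ - (1/2) (∇φ · ∇φ) g_{ab}` of the smooth scalar field `φ`. -/
def IsScalarFieldTensorAt {N : ℕ} {M : Type*} [TopologicalSpace M]
    [ChartedSpace (EuclideanSpace ℝ (Fin N)) M] {x : M}
    (g : LorentzForm (TangentSpace (𝓡 N) x)) (T : LinearMap.BilinForm ℝ (TangentSpace (𝓡 N) x))
    (φ : M → ℝ) : Prop :=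
  ContMDiff (𝓡 N) 𝓘(ℝ, ℝ) ∞ φ ∧ T = g.scalarEnergyMomentum (differentialAt φ x)

/-- The algebraic Rainich conditions of a massless scalar field in dimension `N`: `T` is symmetric,
`(T × T)_{ab} = f g_{ab}` for some scalar `f`, `T_{ab} T^{ab}` is nonnegative (so that the square
root makes sense), and `T_a{}^a = ± (N - 2) √(T_{ab} T^{ab} / N)`. -/
def ScalarRainichConditions {V : Type*} [AddCommGroup V] [Module ℝ V] [FiniteDimensional ℝ V]
    (N : ℕ) (g : LorentzForm V) (T : LinearMap.BilinForm ℝ V) : Prop :=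
  (∀ u v, T u v = T v u) ∧
  (∃ f : ℝ, g.cross T T = f • g.form) ∧
  0 ≤ g.contraction T T ∧
  ∃ β : ℝ, (β = (N : ℝ) - 2 ∨ β = 2 - (N : ℝ)) ∧
    g.metricTrace T = β * √(g.contraction T T / (N : ℝ))

end

/-!
If `T × T = s² g` and `tr T = (2 - N) s`, then `T + s g` has rank at most one: for `s ≠ 0` the mixed
tensor `T_a{}^b` is `s` times a reflection, and the trace says that its eigenvalue `s` is simple;
for `s = 0` its range is totally null, hence at most a line in Lorentzian signature. So
`T + s g = ± α ⊗ α`, and comparing traces gives `2 s = ± α · α`, that is `± T = T{α}`. Replacing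
`T` by `- T` turns the other sign of the trace into this one. A bump function in a chart realizes
`α` as `dφ`. The sign is detected by `T{α}(t, t)`, which is positive for `α ≠ 0` and `t` timelike.
-/

section LinearAlgebra

theorem smul_eq_iff_eq_smul_of_sq_eq_one {G X : Type*} [Monoid G] [MulAction G X] {ε : G}
    (hε : ε ^ 2 = 1) {x y : X} : ε • x = y ↔ x = ε • y := by
  rw [sq] at hε
  constructor <;> rintro rfl <;> rw [smul_smul, hε, one_smul]

/-- An endomorphism squaring to `s ^ 2` has eigenvalues `s` and `-s`, the first with multiplicity
the rank of `A + s`. -/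
theorem trace_eq_of_sq_eq_sq_smul_one {K V : Type*} [Field K] [AddCommGroup V] [Module K V]
    [FiniteDimensional K V] {A : Module.End K V} {s : K} (hs : 2 * s ≠ 0)
    (hA : A * A = s ^ 2 • 1) :
    LinearMap.trace K V A =
      (2 * Module.finrank K (LinearMap.range (A + s • 1)) - Module.finrank K V) * s := by
  have hidem : IsIdempotentElem ((2 * s)⁻¹ • (A + s • 1)) := by
    have hsq : (A + s • 1) * (A + s • 1) = (2 * s) • (A + s • 1) := by
      simp only [mul_add, add_mul, hA, mul_smul_comm, smul_mul_assoc, mul_one, one_mul]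
      module
    rw [IsIdempotentElem, smul_mul_smul_comm, hsq, smul_smul, inv_mul_cancel_right₀ hs]
  have htr := (LinearMap.IsIdempotentElem.isProj_range _ hidem).trace
  rw [LinearMap.range_smul _ _ (inv_ne_zero hs), map_smul, map_add, map_smul, smul_eq_mul,
    inv_mul_eq_iff_eq_mul₀ hs, LinearMap.trace_one, smul_eq_mul] at htr
  linear_combination htr

theorem exists_eq_smul_linMulLin_self {V : Type*} [AddCommGroup V] [Module ℝ V]
    {B : LinearMap.BilinForm ℝ V} (hB : B.IsSymm) (hrange : (LinearMap.range B).IsPrincipal) :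
    ∃ ε : ℝ, ε ^ 2 = 1 ∧ ∃ α, B = ε • LinearMap.BilinForm.linMulLin α α := by
  rcases eq_or_ne B 0 with rfl | hB0
  · exact ⟨1, one_pow 2, 0, by ext; simp⟩
  obtain ⟨v, hv⟩ := LinearMap.BilinForm.exists_bilinForm_self_ne_zero hB0 ⟨hB.eq⟩
  obtain ⟨β, hβ⟩ := hrange
  have hmem (u : V) : ∃ c : ℝ, c • β = B u :=
    Submodule.mem_span_singleton.mp (hβ ▸ LinearMap.mem_range_self B u)
  have hmul (u w : V) : B v v * B u w = B v u * B v w := by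
    obtain ⟨a, ha⟩ := hmem u
    obtain ⟨b, hb⟩ := hmem v
    rw [hB.eq v u, ← ha, ← hb]
    simp only [LinearMap.smul_apply, smul_eq_mul]
    ring
  refine ⟨SignType.sign (B v v), ?_, (√|B v v|)⁻¹ • B v, ?_⟩
  · rcases hv.lt_or_gt with h | h <;> simp [h]
  · ext u w
    have hsq : √|B v v| ^ 2 = SignType.sign (B v v) * B v v := by
      rw [Real.sq_sqrt (abs_nonneg _), sign_mul_self]
    have hsqrt : √|B v v| ≠ 0 := Real.sqrt_ne_zero'.mpr (abs_pos.mpr hv)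
    simp only [LinearMap.smul_apply, LinearMap.BilinForm.linMulLin_apply, smul_eq_mul]
    field_simp
    rw [hsq]
    linear_combination (SignType.sign (B v v) : ℝ) * hmul u w

end LinearAlgebra

namespace LorentzForm

section Causality

variable {V : Type*} [AddCommGroup V] [Module ℝ V] (g : LorentzForm V) {t : V}

theorem isSymm : g.form.IsSymm := ⟨g.symm⟩

theorem form_smul_sub_smul_self (a b : ℝ) (p q : V) :
    g.form (a • p - b • q) (a • p - b • q) =
      a ^ 2 * g.form p p - 2 * a * b * g.form p q + b ^ 2 * g.form q q := by
  simp only [map_sub, map_smul, LinearMap.sub_apply, LinearMap.smul_apply, smul_eq_mul, g.symm q p]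
  ring

theorem form_smul_sub_smul_eq_zero (t p q : V) :
    g.form t (g.form t q • p - g.form t p • q) = 0 := by
  simp only [map_sub, map_smul, smul_eq_mul]
  ring

theorem eq_zero_of_orthogonal {v : V} (ht : 0 < g.form t t) (htv : g.form t v = 0)
    (hv : 0 ≤ g.form v v) : v = 0 := by
  obtain ⟨s, -, hs⟩ := g.signature
  have hneg {u : V} (hsu : g.form s u = 0) (hu : 0 ≤ g.form u u) : u = 0 :=
    by_contra fun hne => (hs u hne hsu).not_ge hu
  -- The combination of `v` and `t` orthogonal to `s` is causal, hence zero.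
  have hcomb : g.form s t • v - g.form s v • t = 0 := by
    refine hneg (g.form_smul_sub_smul_eq_zero s v t) ?_
    rw [form_smul_sub_smul_self, g.symm v t, htv, mul_zero, sub_zero]
    positivity
  have hsv : g.form s v * g.form t t = 0 := by
    simpa [htv] using congrArg (g.form t) hcomb
  exact hneg ((mul_eq_zero_iff_right ht.ne').mp hsv) hv

theorem form_self_nonpos_of_orthogonal {v : V} (ht : 0 < g.form t t) (htv : g.form t v = 0) :
    g.form v v ≤ 0 := by
  by_contra! hv
  simp [g.eq_zero_of_orthogonal ht htv hv.le] at hv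

theorem sq_mul_form_self_add_le (ht : 0 < g.form t t) (p q : V) :
    g.form t q ^ 2 * g.form p p + g.form t p ^ 2 * g.form q q ≤
      2 * g.form t q * g.form t p * g.form p q := by
  have h := g.form_self_nonpos_of_orthogonal ht (g.form_smul_sub_smul_eq_zero t p q)
  rw [form_smul_sub_smul_self] at h
  linarith

theorem form_self_mul_form_self_le_sq (ht : 0 < g.form t t) (p : V) :
    g.form t t * g.form p p ≤ g.form t p ^ 2 := by
  have h := g.sq_mul_form_self_add_le ht p t
  rw [g.symm p t] at h
  exact le_of_mul_le_mul_left (by linarith) ht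

theorem form_nonneg_of_causal {p q : V} (ht : 0 < g.form t t) (hp : 0 ≤ g.form p p)
    (hq : 0 ≤ g.form q q) (htp : 0 ≤ g.form t p) (htq : 0 ≤ g.form t q) : 0 ≤ g.form p q := by
  rcases htp.eq_or_lt with htp0 | htp_pos
  · simp [g.eq_zero_of_orthogonal ht htp0.symm hp]
  rcases htq.eq_or_lt with htq0 | htq_pos
  · simp [g.eq_zero_of_orthogonal ht htq0.symm hq]
  have hle : 0 ≤ 2 * g.form t q * g.form t p * g.form p q :=
    le_trans (by positivity) (g.sq_mul_form_self_add_le ht p q)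
  exact nonneg_of_mul_nonneg_right hle (by positivity)

theorem finrank_le_one_of_form_self_nonneg {W : Submodule ℝ V}
    (hW : ∀ w ∈ W, 0 ≤ g.form w w) : Module.finrank ℝ W ≤ 1 := by
  obtain ⟨t, ht, -⟩ := g.signature
  have hinj : Function.Injective ((g.form t).domRestrict W) := by
    rw [← LinearMap.ker_eq_bot, LinearMap.ker_eq_bot']
    exact fun w hw => Subtype.ext (g.eq_zero_of_orthogonal ht hw (hW w w.2))
  simpa using LinearMap.finrank_le_finrank_of_injective hinj

variable [FiniteDimensional ℝ V]

theorem finrank_pos (g : LorentzForm V) : 0 < Module.finrank ℝ V := by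
  obtain ⟨t, ht, -⟩ := g.signature
  exact Module.finrank_pos_iff_exists_ne_zero.mpr ⟨t, by rintro rfl; simp at ht⟩

/-- `A` maps the hyperplane orthogonal to a timelike vector injectively to a nonnegative subspace,
which is at most a line. -/
theorem finrank_eq_two_of_form_map_self_eq_mul (g : LorentzForm V) {A : Module.End ℝ V} {f : ℝ}
    (hf : f < 0) (hA : ∀ v, g.form (A v) (A v) = f * g.form v v) : Module.finrank ℝ V = 2 := by
  obtain ⟨t, ht, -⟩ := g.signature
  have ht0 : g.form t ≠ 0 := fun h => by simp [h] at ht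
  set A' := A.domRestrict (LinearMap.ker (g.form t))
  have hinj : Function.Injective A' := by
    rw [← LinearMap.ker_eq_bot, LinearMap.ker_eq_bot']
    rintro ⟨v, hv⟩ hAv
    have hnull : f * g.form v v = 0 := by simp [← hA, show A v = 0 from hAv]
    exact Subtype.ext (g.eq_zero_of_orthogonal ht hv ((mul_eq_zero_iff_left hf.ne).mp hnull).ge)
  have hrange : Module.finrank ℝ (LinearMap.range A') ≤ 1 := by
    refine g.finrank_le_one_of_form_self_nonneg ?_
    rintro _ ⟨⟨v, hv⟩, rfl⟩
    exact (hA v).symm ▸ mul_nonneg_of_nonpos_of_nonpos hf.le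
      (g.form_self_nonpos_of_orthogonal ht hv)
  have hle : Module.finrank ℝ V ≤ 2 := by
    rw [LinearMap.finrank_range_of_inj hinj] at hrange
    have := Module.Dual.finrank_ker_add_one_of_ne_zero ht0
    omega
  have hne : Module.finrank ℝ V ≠ 1 := fun h1 => by
    obtain ⟨c, hc⟩ := (finrank_eq_one_iff_of_nonzero' t (ne_zero_of_map ht0)).mp h1 (A t)
    have hAt := hA t
    rw [← hc] at hAt
    simp only [map_smul, LinearMap.smul_apply, smul_eq_mul] at hAt
    nlinarith [mul_nonneg (mul_self_nonneg c) ht.le]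
  have := g.finrank_pos
  omega

end Causality

section MixedTensor

variable {V : Type*} [AddCommGroup V] [Module ℝ V] [FiniteDimensional ℝ V] (g : LorentzForm V)
  {S T : LinearMap.BilinForm ℝ V}

@[simp]
theorem form_sharp (α : Module.Dual ℝ V) (v : V) : g.form (g.sharp α) v = α v :=
  LinearMap.BilinForm.apply_toDual_symm_apply α v

theorem form_sharp_right (α : Module.Dual ℝ V) (v : V) : g.form v (g.sharp α) = α v := by
  rw [g.symm, form_sharp]

theorem sharp_form (v : V) : g.sharp (g.form v) = v :=
  (g.form.toDual g.nondegenerate).symm_apply_apply v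

theorem cometric_apply (α β : Module.Dual ℝ V) : g.cometric α β = α (g.sharp β) :=
  g.form_sharp α (g.sharp β)

/-- The mixed tensor `T_a{}^b` obtained from `T_{ab}` by raising its second index, as an
endomorphism of `V`. -/
noncomputable def mixed : LinearMap.BilinForm ℝ V →ₗ[ℝ] Module.End ℝ V :=
  LinearMap.compRight ℝ g.sharp

@[simp]
theorem form_mixed (T : LinearMap.BilinForm ℝ V) (u v : V) : g.form (g.mixed T u) v = T u v :=
  g.form_sharp (T u) v

theorem mixed_form : g.mixed g.form = 1 :=
  LinearMap.ext g.sharp_form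

theorem finrank_range_mixed (T : LinearMap.BilinForm ℝ V) :
    Module.finrank ℝ (LinearMap.range (g.mixed T)) = Module.finrank ℝ (LinearMap.range T) := by
  rw [← (g.form.toDual g.nondegenerate).symm.finrank_map_eq (LinearMap.range T)]
  exact congrArg (fun W : Submodule ℝ V => Module.finrank ℝ W) (LinearMap.range_comp T g.sharp)

theorem metricTrace_eq_trace_mixed (T : LinearMap.BilinForm ℝ V) :
    g.metricTrace T = LinearMap.trace ℝ V (g.mixed T) := rfl

theorem metricTrace_add (S T : LinearMap.BilinForm ℝ V) :
    g.metricTrace (S + T) = g.metricTrace S + g.metricTrace T := by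
  simp only [metricTrace_eq_trace_mixed, map_add]

theorem metricTrace_smul (c : ℝ) (T : LinearMap.BilinForm ℝ V) :
    g.metricTrace (c • T) = c * g.metricTrace T := by
  simp only [metricTrace_eq_trace_mixed, map_smul, smul_eq_mul]

theorem metricTrace_form : g.metricTrace g.form = Module.finrank ℝ V := by
  rw [metricTrace_eq_trace_mixed, mixed_form, LinearMap.trace_one]

theorem mixed_linMulLin (α β : Module.Dual ℝ V) :
    g.mixed (LinearMap.BilinForm.linMulLin α β) = α.smulRight (g.sharp β) :=
  LinearMap.ext fun u => map_smul g.sharp (α u) β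

theorem metricTrace_linMulLin (α β : Module.Dual ℝ V) :
    g.metricTrace (LinearMap.BilinForm.linMulLin α β) = g.cometric α β := by
  rw [metricTrace_eq_trace_mixed, mixed_linMulLin, LinearMap.trace_smulRight, cometric_apply]

theorem cross_apply (S T : LinearMap.BilinForm ℝ V) (u v : V) :
    g.cross S T u v = g.form (g.mixed S u) (g.mixed T v) := rfl

theorem cross_smul_smul (c : ℝ) (T : LinearMap.BilinForm ℝ V) :
    g.cross (c • T) (c • T) = c ^ 2 • g.cross T T := by
  ext u v
  simp only [cross_apply, map_smul, LinearMap.smul_apply, smul_eq_mul]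
  ring

theorem mixed_cross (S : LinearMap.BilinForm ℝ V) (hT : T.IsSymm) :
    g.mixed (g.cross S T) = g.mixed T * g.mixed S := by
  have hcross : g.cross S T = T ∘ₗ g.mixed S :=
    LinearMap.BilinForm.ext fun u v => by
      rw [cross_apply, g.symm, form_mixed, hT.eq, LinearMap.comp_apply]
  rw [hcross]
  rfl

theorem contraction_smul_smul (c : ℝ) (T : LinearMap.BilinForm ℝ V) :
    g.contraction (c • T) (c • T) = c ^ 2 * g.contraction T T := by
  rw [contraction, cross_smul_smul, metricTrace_smul, contraction]

theorem contraction_of_cross_eq {f : ℝ} (h : g.cross S T = f • g.form) :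
    g.contraction S T = f * Module.finrank ℝ V := by
  rw [contraction, h, metricTrace_smul, metricTrace_form]

theorem contraction_div_finrank_of_cross_eq {f : ℝ} (h : g.cross S T = f • g.form) :
    g.contraction S T / Module.finrank ℝ V = f := by
  rw [g.contraction_of_cross_eq h, mul_div_cancel_right₀ _ (mod_cast g.finrank_pos.ne')]

theorem contraction_self_nonneg (hV : Module.finrank ℝ V ≠ 2) {f : ℝ}
    (hf : g.cross T T = f • g.form) : 0 ≤ g.contraction T T := by
  rw [g.contraction_of_cross_eq hf]
  refine mul_nonneg (not_lt.mp fun hneg => hV ?_) (Nat.cast_nonneg _)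
  exact g.finrank_eq_two_of_form_map_self_eq_mul (A := g.mixed T) hneg fun v => by
    rw [← cross_apply, hf, LinearMap.smul_apply, LinearMap.smul_apply, smul_eq_mul]

end MixedTensor

section ScalarEnergyMomentum

variable {V : Type*} [AddCommGroup V] [Module ℝ V] [FiniteDimensional ℝ V] (g : LorentzForm V)

@[simp]
theorem scalarEnergyMomentum_zero : g.scalarEnergyMomentum 0 = 0 := by
  ext
  simp [scalarEnergyMomentum]

theorem scalarEnergyMomentum_apply (α : Module.Dual ℝ V) (u v : V) :
    g.scalarEnergyMomentum α u v = α u * α v - 1 / 2 * g.cometric α α * g.form u v := by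
  simp [scalarEnergyMomentum]

theorem isSymm_scalarEnergyMomentum (α : Module.Dual ℝ V) :
    (g.scalarEnergyMomentum α).IsSymm := by
  refine ⟨fun u v => ?_⟩
  rw [scalarEnergyMomentum_apply, scalarEnergyMomentum_apply, g.symm u v, mul_comm (α u)]

theorem mixed_scalarEnergyMomentum (α : Module.Dual ℝ V) :
    g.mixed (g.scalarEnergyMomentum α) =
      α.smulRight (g.sharp α) - (1 / 2 * g.cometric α α) • 1 := by
  refine LinearMap.ext fun u => ?_
  change g.sharp (α u • α - (1 / 2 * g.cometric α α) • g.form u) =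
    α u • g.sharp α - (1 / 2 * g.cometric α α) • u
  rw [map_sub, map_smul, map_smul, sharp_form]

theorem cross_scalarEnergyMomentum (α : Module.Dual ℝ V) :
    g.cross (g.scalarEnergyMomentum α) (g.scalarEnergyMomentum α) =
      (g.cometric α α / 2) ^ 2 • g.form := by
  ext u v
  simp only [cross_apply, mixed_scalarEnergyMomentum, LinearMap.sub_apply, LinearMap.smul_apply,
    LinearMap.smulRight_apply, Module.End.one_apply, map_sub, map_smul, smul_eq_mul, form_sharp,
    form_sharp_right, cometric_apply]
  ring

theorem metricTrace_scalarEnergyMomentum (α : Module.Dual ℝ V) :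
    g.metricTrace (g.scalarEnergyMomentum α) =
      (2 - Module.finrank ℝ V) * (g.cometric α α / 2) := by
  rw [metricTrace_eq_trace_mixed, mixed_scalarEnergyMomentum, map_sub, map_smul,
    LinearMap.trace_smulRight, LinearMap.trace_one, ← cometric_apply, smul_eq_mul]
  ring

theorem sqrt_contraction_scalarEnergyMomentum (α : Module.Dual ℝ V) :
    √(g.contraction (g.scalarEnergyMomentum α) (g.scalarEnergyMomentum α) /
      Module.finrank ℝ V) = |g.cometric α α| / 2 := by
  rw [g.contraction_div_finrank_of_cross_eq (g.cross_scalarEnergyMomentum α), Real.sqrt_sq_eq_abs,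
    abs_div, abs_two]

theorem scalarRainichConditions_scalarEnergyMomentum (α : Module.Dual ℝ V) :
    ScalarRainichConditions (Module.finrank ℝ V) g (g.scalarEnergyMomentum α) := by
  refine ⟨(g.isSymm_scalarEnergyMomentum α).eq, ⟨_, g.cross_scalarEnergyMomentum α⟩, ?_, ?_⟩
  · rw [g.contraction_of_cross_eq (g.cross_scalarEnergyMomentum α)]
    positivity
  · rw [sqrt_contraction_scalarEnergyMomentum, metricTrace_scalarEnergyMomentum]
    rcases abs_choice (g.cometric α α) with h | h <;> rw [h]
    · exact ⟨_, Or.inr rfl, rfl⟩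
    · exact ⟨_, Or.inl rfl, by ring⟩

theorem isSpacelike_of_metricTrace_eq {α : Module.Dual ℝ V}
    (htr : g.metricTrace (g.scalarEnergyMomentum α) = (Module.finrank ℝ V - 2) *
      √(g.contraction (g.scalarEnergyMomentum α) (g.scalarEnergyMomentum α) / Module.finrank ℝ V))
    (htr0 : g.metricTrace (g.scalarEnergyMomentum α) ≠ 0) : g.IsSpacelike α := by
  rw [metricTrace_scalarEnergyMomentum] at htr htr0
  rw [sqrt_contraction_scalarEnergyMomentum] at htr
  obtain ⟨hdim, hsq⟩ := mul_ne_zero_iff.mp htr0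
  have hneg : g.cometric α α / 2 = -(|g.cometric α α| / 2) := mul_left_cancel₀ hdim (by linarith)
  have habs : 0 < |g.cometric α α| := abs_pos.mpr fun h => hsq (by rw [h, zero_div])
  rw [IsSpacelike]
  linarith

theorem isTimelike_of_metricTrace_eq {α : Module.Dual ℝ V}
    (htr : g.metricTrace (g.scalarEnergyMomentum α) = (2 - Module.finrank ℝ V) *
      √(g.contraction (g.scalarEnergyMomentum α) (g.scalarEnergyMomentum α) / Module.finrank ℝ V))
    (htr0 : g.metricTrace (g.scalarEnergyMomentum α) ≠ 0) : g.IsTimelike α := by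
  rw [metricTrace_scalarEnergyMomentum] at htr htr0
  rw [sqrt_contraction_scalarEnergyMomentum] at htr
  obtain ⟨hdim, hsq⟩ := mul_ne_zero_iff.mp htr0
  have hpos : g.cometric α α / 2 = |g.cometric α α| / 2 := mul_left_cancel₀ hdim htr
  have habs : 0 < |g.cometric α α| := abs_pos.mpr fun h => hsq (by rw [h, zero_div])
  rw [IsTimelike]
  linarith

theorem isNull_or_eq_zero_of_contraction_eq_zero {α : Module.Dual ℝ V}
    (h : g.contraction (g.scalarEnergyMomentum α) (g.scalarEnergyMomentum α) = 0) :
    g.IsNull α ∨ α = 0 := by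
  have habs := g.sqrt_contraction_scalarEnergyMomentum α
  rw [h, zero_div, Real.sqrt_zero, eq_comm, div_eq_zero_iff, abs_eq_zero] at habs
  exact (em (α = 0)).symm.imp_left fun hα => ⟨hα, habs.resolve_right two_ne_zero⟩

end ScalarEnergyMomentum

section Rainich

variable {V : Type*} [AddCommGroup V] [Module ℝ V] [FiniteDimensional ℝ V] (g : LorentzForm V)
  {T : LinearMap.BilinForm ℝ V}

theorem scalarRainichConditions_smul {N : ℕ} {ε : ℝ} (hε : ε ^ 2 = 1)
    (hT : ScalarRainichConditions N g T) : ScalarRainichConditions N g (ε • T) := by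
  obtain ⟨hsymm, ⟨f, hf⟩, hnonneg, β, hβ, htr⟩ := hT
  have hcontr : g.contraction (ε • T) (ε • T) = g.contraction T T := by
    rw [contraction_smul_smul, hε, one_mul]
  refine ⟨fun u v => by simp [hsymm u v], ⟨f, by rw [cross_smul_smul, hf, hε, one_smul]⟩,
    hcontr ▸ hnonneg, ε * β, ?_, by rw [hcontr, metricTrace_smul, htr, mul_assoc]⟩
  rcases sq_eq_one_iff.mp hε with rfl | rfl
  · rwa [one_mul]
  · rw [neg_one_mul, neg_eq_iff_eq_neg, neg_eq_iff_eq_neg, neg_sub, neg_sub]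
    exact hβ.symm

theorem finrank_range_mixed_add_smul_one_le_one (hT : T.IsSymm) {s : ℝ}
    (hcross : g.cross T T = s ^ 2 • g.form)
    (htr : g.metricTrace T = (2 - Module.finrank ℝ V) * s) :
    Module.finrank ℝ (LinearMap.range (g.mixed T + s • 1)) ≤ 1 := by
  rcases eq_or_ne s 0 with rfl | hs
  · rw [zero_smul, add_zero]
    refine g.finrank_le_one_of_form_self_nonneg ?_
    rintro _ ⟨u, rfl⟩
    rw [← cross_apply, hcross]
    simp
  · have hsq : g.mixed T * g.mixed T = s ^ 2 • 1 := by
      rw [← g.mixed_cross T hT, hcross, map_smul, mixed_form]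
    have hrank := trace_eq_of_sq_eq_sq_smul_one (mul_ne_zero two_ne_zero hs) hsq
    rw [← metricTrace_eq_trace_mixed, htr] at hrank
    have hone := mul_right_cancel₀ hs hrank
    exact_mod_cast (by linarith : (Module.finrank ℝ (LinearMap.range (g.mixed T + s • 1)) : ℝ) ≤ 1)

theorem exists_smul_eq_scalarEnergyMomentum (hT : T.IsSymm) {s : ℝ}
    (hcross : g.cross T T = s ^ 2 • g.form)
    (htr : g.metricTrace T = (2 - Module.finrank ℝ V) * s) :
    ∃ ε : ℝ, ε ^ 2 = 1 ∧ ∃ α, ε • T = g.scalarEnergyMomentum α := by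
  have hrank : (LinearMap.range (T + s • g.form)).IsPrincipal := by
    have : Module.Free ℝ (LinearMap.range (T + s • g.form)) :=
      .of_divisionRing ℝ (LinearMap.range (T + s • g.form))
    rw [← Submodule.finrank_le_one_iff_isPrincipal, ← g.finrank_range_mixed, map_add, map_smul,
      mixed_form]
    exact g.finrank_range_mixed_add_smul_one_le_one hT hcross htr
  obtain ⟨ε, hε, α, hα⟩ := exists_eq_smul_linMulLin_self (hT.add (g.isSymm.smul s)) hrank
  have hnorm : 2 * s = ε * g.cometric α α := by
    rw [← metricTrace_linMulLin, ← metricTrace_smul, ← hα, metricTrace_add, metricTrace_smul,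
      metricTrace_form, htr]
    ring
  have hs : ε * s = 1 / 2 * g.cometric α α := by
    linear_combination ε / 2 * hnorm + g.cometric α α / 2 * hε
  refine ⟨ε, hε, α, ?_⟩
  rw [scalarEnergyMomentum, ← hs, ← (smul_eq_iff_eq_smul_of_sq_eq_one hε).mpr hα]
  module

theorem scalarRainichConditions_iff :
    ScalarRainichConditions (Module.finrank ℝ V) g T ↔
      ∃ ε : ℝ, ε ^ 2 = 1 ∧ ∃ α, ε • T = g.scalarEnergyMomentum α := by
  constructor
  · rintro ⟨hsymm, ⟨f, hf⟩, hnonneg, β, hβ, htr⟩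
    rw [g.contraction_div_finrank_of_cross_eq hf] at htr
    have hf0 : 0 ≤ f := g.contraction_div_finrank_of_cross_eq hf ▸
      div_nonneg hnonneg (Nat.cast_nonneg _)
    obtain ⟨ε, hε, hεβ⟩ : ∃ ε : ℝ, ε ^ 2 = 1 ∧ ε * β = 2 - Module.finrank ℝ V := by
      rcases hβ with rfl | rfl
      · exact ⟨-1, by norm_num, by ring⟩
      · exact ⟨1, by norm_num, by ring⟩
    have hsymm' : (ε • T).IsSymm := ⟨fun u v => by simp [hsymm u v]⟩
    obtain ⟨δ, hδ, α, hα⟩ := g.exists_smul_eq_scalarEnergyMomentum hsymm' (s := √f)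
      (by rw [cross_smul_smul, hf, hε, one_smul, Real.sq_sqrt hf0])
      (by rw [metricTrace_smul, htr, ← mul_assoc, hεβ])
    exact ⟨δ * ε, by rw [mul_pow, hδ, hε, one_mul], α, by rw [← hα, smul_smul]⟩
  · rintro ⟨ε, hε, α, hα⟩
    rw [(smul_eq_iff_eq_smul_of_sq_eq_one hε).mp hα]
    exact g.scalarRainichConditions_smul hε (g.scalarRainichConditions_scalarEnergyMomentum α)

end Rainich

section DominantProperty

variable {V : Type*} [AddCommGroup V] [Module ℝ V] [FiniteDimensional ℝ V] (g : LorentzForm V)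
  {t : V}

theorem scalarEnergyMomentum_self_pos (ht : 0 < g.form t t) {α : Module.Dual ℝ V} (hα : α ≠ 0) :
    0 < g.scalarEnergyMomentum α t t := by
  have hcs : g.form t t * g.cometric α α ≤ α t ^ 2 :=
    g.form_sharp_right α t ▸ g.form_self_mul_form_self_le_sq ht (g.sharp α)
  rw [scalarEnergyMomentum_apply]
  rcases eq_or_ne (α t) 0 with hαt | hαt
  · have hneg : g.cometric α α < 0 := by
      refine not_le.mp fun hnonneg => hα ?_
      have hsharp := g.eq_zero_of_orthogonal ht ((g.form_sharp_right α t).trans hαt) hnonneg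
      exact LinearMap.ext fun v => by rw [← g.form_sharp α v, hsharp, map_zero]
    rw [hαt]
    nlinarith
  · nlinarith [sq_pos_of_ne_zero hαt]

/-- Lowering `u` with the tensor gives a causal vector because `T × T` is a nonnegative multiple
of the metric, so it suffices that the products of causal vectors are nonnegative. -/
theorem hasDominantProperty_scalarEnergyMomentum (ht : 0 < g.form t t) (α : Module.Dual ℝ V) :
    g.HasDominantProperty t (g.scalarEnergyMomentum α) := by
  rintro u w ⟨hu, htu⟩ ⟨hw, htw⟩
  set T := g.scalarEnergyMomentum α with hT
  have hcausal {v : V} (hv : 0 ≤ g.form v v) : 0 ≤ g.form (g.mixed T v) (g.mixed T v) := by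
    rw [← cross_apply, hT, cross_scalarEnergyMomentum, LinearMap.smul_apply,
      LinearMap.smul_apply, smul_eq_mul]
    positivity
  have htt : 0 ≤ g.form t (g.mixed T t) := by
    rw [g.symm, form_mixed]
    rcases eq_or_ne α 0 with rfl | hα
    · simp [hT]
    · exact (g.scalarEnergyMomentum_self_pos ht hα).le
  have htu' : 0 ≤ g.form t (g.mixed T u) := by
    rw [g.symm, form_mixed, (g.isSymm_scalarEnergyMomentum α).eq, ← form_mixed]
    exact g.form_nonneg_of_causal ht (hcausal ht.le) hu htt htu.le
  rw [← form_mixed]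
  exact g.form_nonneg_of_causal ht (hcausal hu) hw htu' htw.le

theorem exists_eq_scalarEnergyMomentum_iff (ht : 0 < g.form t t) {T : LinearMap.BilinForm ℝ V} :
    (∃ α, T = g.scalarEnergyMomentum α) ↔
      ScalarRainichConditions (Module.finrank ℝ V) g T ∧ g.HasDominantProperty t T := by
  constructor
  · rintro ⟨α, rfl⟩
    exact ⟨g.scalarRainichConditions_scalarEnergyMomentum α,
      g.hasDominantProperty_scalarEnergyMomentum ht α⟩
  · rintro ⟨hR, hdom⟩
    obtain ⟨ε, hε, α, hα⟩ := g.scalarRainichConditions_iff.mp hR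
    rcases sq_eq_one_iff.mp hε with rfl | rfl
    · exact ⟨α, by rw [← hα, one_smul]⟩
    -- With the sign `-1` both `T t t` and `-T t t` are nonnegative, which forces `α = 0`.
    · have hTtt : 0 ≤ T t t := hdom t t ⟨ht.le, ht⟩ ⟨ht.le, ht⟩
      have hα0 : α = 0 := by
        by_contra hne
        have hpos := g.scalarEnergyMomentum_self_pos ht hne
        rw [← hα, LinearMap.smul_apply, LinearMap.smul_apply, smul_eq_mul] at hpos
        linarith
      refine ⟨0, ?_⟩
      rw [(smul_eq_iff_eq_smul_of_sq_eq_one hε).mp hα, hα0, scalarEnergyMomentum_zero, smul_zero]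

end DominantProperty

end LorentzForm

section Manifold

variable {E H M F : Type*} [NormedAddCommGroup E] [NormedSpace ℝ E] [FiniteDimensional ℝ E]
  [TopologicalSpace H] {I : ModelWithCorners ℝ E H} [TopologicalSpace M] [T2Space M]
  [ChartedSpace H M] [IsManifold I ∞ M] [NormedAddCommGroup F] [NormedSpace ℝ F]

theorem exists_contMDiff_eventuallyEq {x : M} {g : M → F}
    (hg : ContMDiffOn I 𝓘(ℝ, F) ∞ g (chartAt H x).source) :
    ∃ φ : M → F, ContMDiff I 𝓘(ℝ, F) ∞ φ ∧ φ =ᶠ[nhds x] g := by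
  obtain ⟨f⟩ : Nonempty (SmoothBumpFunction I x) := inferInstance
  refine ⟨fun y => f y • g y, f.contMDiff_smul hg, ?_⟩
  filter_upwards [f.eventuallyEq_one] with y hy
  rw [hy, Pi.one_apply, one_smul]

theorem exists_contMDiff_mvfderiv_eq (x : M) (L : TangentSpace I x →L[ℝ] F) :
    ∃ φ : M → F, ContMDiff I 𝓘(ℝ, F) ∞ φ ∧ mvfderiv I φ x = L := by
  have : IsManifold I 1 M := .of_le (n := ∞) (by norm_num)
  obtain ⟨e, he⟩ := isInvertible_mfderiv_extChartAt (mem_extChartAt_source (I := I) x)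
  let L' : E →L[ℝ] F := L ∘L e.symm.toContinuousLinearMap
  obtain ⟨φ, hφ, hφx⟩ := exists_contMDiff_eventuallyEq
    (L'.contMDiff.comp_contMDiffOn (contMDiffOn_extChartAt (I := I) (n := ∞) (x := x)))
  refine ⟨φ, hφ, ?_⟩
  have hderiv : mfderiv I 𝓘(ℝ, F) φ x = L' ∘L mfderiv I 𝓘(ℝ, E) (extChartAt I x) x := by
    rw [hφx.mfderiv_eq, mfderiv_comp x L'.mdifferentiableAt
      (mdifferentiableAt_extChartAt (mem_chart_source _ x)), L'.mfderiv_eq]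
    rfl
  ext v
  change mfderiv I 𝓘(ℝ, F) φ x v = L v
  rw [hderiv, ← he]
  exact congrArg L (e.symm_apply_apply v)

theorem finrank_tangentSpace {N : ℕ} {M : Type*} [TopologicalSpace M]
    [ChartedSpace (EuclideanSpace ℝ (Fin N)) M] (x : M) :
    Module.finrank ℝ (TangentSpace (𝓡 N) x) = N :=
  finrank_euclideanSpace_fin (𝕜 := ℝ) (n := N)

theorem exists_isScalarFieldTensorAt_iff {N : ℕ} {M : Type*} [TopologicalSpace M] [T2Space M]
    [ChartedSpace (EuclideanSpace ℝ (Fin N)) M] [IsManifold (𝓡 N) ∞ M] {x : M}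
    {g : LorentzForm (TangentSpace (𝓡 N) x)}
    {T : LinearMap.BilinForm ℝ (TangentSpace (𝓡 N) x)} :
    (∃ φ : M → ℝ, IsScalarFieldTensorAt g T φ) ↔ ∃ α, T = g.scalarEnergyMomentum α := by
  refine ⟨fun ⟨φ, _, hT⟩ => ⟨_, hT⟩, fun ⟨α, hT⟩ => ?_⟩
  have : T2Space (TangentSpace (𝓡 N) x) := inferInstanceAs (T2Space (EuclideanSpace ℝ (Fin N)))
  obtain ⟨φ, hφ, hα⟩ := exists_contMDiff_mvfderiv_eq x (LinearMap.toContinuousLinearMap α)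
  exact ⟨φ, hφ, by rw [hT, differentialAt, hα]; rfl⟩

end Manifold

theorem mainTheorem10 {N : ℕ} {M : Type*} [TopologicalSpace M] [T2Space M]
    [ChartedSpace (EuclideanSpace ℝ (Fin N)) M] [IsManifold (𝓡 N) ∞ M]
    (x : M) (g : LorentzForm (TangentSpace (𝓡 N) x))
    (T : LinearMap.BilinForm ℝ (TangentSpace (𝓡 N) x)) :
    -- up to sign, `T` is the tensor of a scalar field exactly when the conditions hold
    ((∃ ε : ℝ, (ε = 1 ∨ ε = -1) ∧ ∃ φ : M → ℝ, IsScalarFieldTensorAt g (ε • T) φ) ↔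
      ScalarRainichConditions N g T) ∧
    -- the sign is `+` exactly when `T` has the dominant property
    (∀ t, 0 < g.form t t →
      ((∃ φ : M → ℝ, IsScalarFieldTensorAt g T φ) ↔
        ScalarRainichConditions N g T ∧ g.HasDominantProperty t T)) ∧
    -- the radicand is automatically nonnegative, except in dimension two
    (N ≠ 2 → (∀ u v, T u v = T v u) → (∃ f : ℝ, g.cross T T = f • g.form) →
      0 ≤ g.contraction T T) ∧
    -- the causal character of `dφ`
    (∀ ε : ℝ, (ε = 1 ∨ ε = -1) → ∀ φ : M → ℝ, IsScalarFieldTensorAt g (ε • T) φ →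
      (ε * g.metricTrace T = ((N : ℝ) - 2) * √(g.contraction T T / (N : ℝ)) →
        g.metricTrace T ≠ 0 → g.IsSpacelike (differentialAt φ x)) ∧
      (ε * g.metricTrace T = (2 - (N : ℝ)) * √(g.contraction T T / (N : ℝ)) →
        g.metricTrace T ≠ 0 → g.IsTimelike (differentialAt φ x)) ∧
      (g.metricTrace T = 0 → g.contraction T T = 0 →
        g.IsNull (differentialAt φ x) ∨ (T = 0 ∧ differentialAt (N := N) φ x = 0))) := by
  simp only [exists_isScalarFieldTensorAt_iff, ← sq_eq_one_iff]
  have hrank := finrank_tangentSpace (N := N) x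
  refine ⟨?_, fun t ht => ?_, fun hN _ ⟨f, hf⟩ => ?_, ?_⟩
  · simpa only [hrank] using g.scalarRainichConditions_iff.symm
  · simpa only [hrank] using g.exists_eq_scalarEnergyMomentum_iff ht
  · exact g.contraction_self_nonneg (hrank.trans_ne hN) hf
  · rintro ε hε φ ⟨-, hφ⟩
    obtain rfl := (smul_eq_iff_eq_smul_of_sq_eq_one hε).mp hφ
    simp only [LorentzForm.metricTrace_smul, LorentzForm.contraction_smul_smul, ← mul_assoc, ← sq,
      hε, one_mul, ← hrank]
    refine ⟨fun htr h0 => ?_, fun htr h0 => ?_, fun _ hcontr => ?_⟩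
    · exact g.isSpacelike_of_metricTrace_eq htr (right_ne_zero_of_mul h0)
    · exact g.isTimelike_of_metricTrace_eq htr (right_ne_zero_of_mul h0)
    · refine (g.isNull_or_eq_zero_of_contraction_eq_zero hcontr).imp_right fun hα => ⟨?_, hα⟩
      rw [hα, LorentzForm.scalarEnergyMomentum_zero, smul_zero]
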